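/- Theorem. A BDD here means a quasi-reduced (multi-terminal) OBDD: a layered decision diagram over $n$ Boolean variables in which no ply is skipped, every node is reachable from the root, equal sub-DAGs are shared, and there is one leaf per terminal value; $|B|$ denotes the number of nodes of $B$ (leaves included). A CFLOBDD at level $k$ is a finite hierarchy of groupings, all reachable along call edges from a single level-$k$ head. Each grouping has one entry vertex and an ordered set of exit vertices. A level-$0$ grouping reads one variable and is either a fork grouping (two exits) or a don't-care grouping (one exit). A grouping $g$ at level $l\ge 1$ has an ordered set of middle vertices, an A-call to a level-$(l-1)$ grouping with a return tuple from the exits of the callee to the middle vertices of $g$, and for each middle vertex a B-call to a level-$(l-1)$ grouping with a return tuple from the exits of the callee to the exits of $g$. The exits of the head carry terminal values. An assignment to $2^k$ variables is interpreted by the matched path: the A-callee reads the first half of the variables, and the B-callee of the middle vertex returned to reads the second half, returning along the matching edges. The following invariants hold: (1) A-return tuples are the identity onto the middle vertices; (2) B-return tuples are injective, each compactly extends the set of exits targeted by the preceding ones (the new exits appear in the tuple in order, without gaps), and every exit of $g$ is targeted by some B-return edge; (3) there are no two separate instances of equal sub-structures; (4) two B-connections of the same grouping with equal callees have different return tuples;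 (5) the exits of the head have distinct terminal values. Then there is an absolute constant $c$ such that the following holds. Let $V$ be any set of values, $k\ge 0$, $f:\{0,1\}^{2^k}\to V$, and let $B$ and $C$ be a BDD and a level-$k$ CFLOBDD that represent $f$ with the same variable ordering. Then the number $|V(C)|$ of vertices (entry, middle and exit vertices of all groupings) of $C$ satisfies $|V(C)|\le c\,|B|^2$; that is, $|V(C)|=O(|B|^2)$. -/

import Mathlib

/-! ### Binary decision diagrams without ply-skipping -/

/-- A layered, multi-terminal decision diagram over `n` Boolean variables: `Node d` is the finite
set of nodes at depth `d`. Every node at a depth `d < n` has a `false`-successor and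
a `true`-successor at depth `d + 1`; the nodes at depth `n` carry terminal values. -/
structure DecisionDiagram (n : ℕ) (V : Type*) where
  Node : ℕ → Type
  fintypeNode : ∀ d, Fintype (Node d)
  root : Node 0
  child : ∀ {d : ℕ}, d < n → Node d → Bool → Node (d + 1)
  value : Node n → V

namespace DecisionDiagram

variable {n : ℕ} {V : Type*}

attribute [instance] DecisionDiagram.fintypeNode

/-- The node reached from the root after interpreting the first `d` variables. -/
def walk (B : DecisionDiagram n V) (x : Fin n → Bool) : ∀ d : ℕ, d ≤ n → B.Node d
  | 0, _ => B.root
  | d + 1, h => B.child h (B.walk x d (Nat.le_of_succ_le h)) (x ⟨d, h⟩)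

/-- The result of interpreting the assignment `x`, where `x i` is the value of the `i`-th variable
that is read. -/
def eval (B : DecisionDiagram n V) (x : Fin n → Bool) : V :=
  B.value (B.walk x n le_rfl)

/-- The nodes that can be reached from the root. -/
inductive Reachable (B : DecisionDiagram n V) : ∀ {d : ℕ}, B.Node d → Prop
  | root : Reachable B B.root
  | child {d : ℕ} (h : d < n) {u : B.Node d} (b : Bool) :
      Reachable B u → Reachable B (B.child h u b)

/-- A quasi-reduced (multi-terminal) OBDD: every node is reachable from the root, and equal
sub-DAGs are shared, i.e. there is at most one leaf for each terminal value and no two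
different nodes at the same depth have the same `false`-successor and the same
`true`-successor. (Don't-care nodes are kept: plies are never skipped.) -/
structure IsBDD (B : DecisionDiagram n V) : Prop where
  reachable : ∀ {d : ℕ} (u : B.Node d), B.Reachable u
  shared : ∀ {d : ℕ} (h : d < n) (u v : B.Node d),
    (∀ b : Bool, B.child h u b = B.child h v b) → u = v
  value_injective : Function.Injective B.value

/-- `B` represents `f` under the variable ordering `Ord`: the `i`-th variable read is
`Ord i`. -/
def Represents (B : DecisionDiagram n V) (Ord : Equiv.Perm (Fin n))
    (f : (Fin n → Bool) → V) : Prop :=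
  ∀ x : Fin n → Bool, B.eval (fun i => x (Ord i)) = f x

/-- `|B|`, the number of nodes (at all depths `0, …, n`, leaves included). -/
def size (B : DecisionDiagram n V) : ℕ :=
  ∑ d ∈ Finset.range (n + 1), Fintype.card (B.Node d)

end DecisionDiagram

/-! ### CFLOBDDs -/

/-- The basic structure of a (mock-)CFLOBDD at level `k` with terminal values in `V`.
`Grp l` is the finite set of groupings at level `l`. Exit vertices and middle vertices of a
grouping are numbered from `0`, in their given order.
* A level-`0` grouping is a fork grouping (two exits) or a don't-care grouping (one exit).
* A grouping `g` at level `l + 1` has `numMid g` middle vertices, an A-call edge to `callA g`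
  with return edges `retA g` from the exits of the callee to the middle vertices of `g`, and, for
  each middle vertex `m`, a B-call edge to `callB g m` with return edges `retB g m` from the exits
  of the callee to the exits of `g`.
* `value` gives the value edges from the exits of the head to terminal values. -/
structure MockCFLOBDD (k : ℕ) (V : Type*) where
  Grp : ℕ → Type
  fintypeGrp : ∀ l, Fintype (Grp l)
  numExits : ∀ {l : ℕ}, Grp l → ℕ
  isFork : Grp 0 → Bool
  numExits_zero : ∀ g : Grp 0, numExits g = if isFork g then 2 else 1
  numMid : ∀ {l : ℕ}, Grp (l + 1) → ℕ
  callA : ∀ {l : ℕ}, Grp (l + 1) → Grp l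
  retA : ∀ {l : ℕ} (g : Grp (l + 1)), Fin (numExits (callA g)) → Fin (numMid g)
  callB : ∀ {l : ℕ} (g : Grp (l + 1)), Fin (numMid g) → Grp l
  retB : ∀ {l : ℕ} (g : Grp (l + 1)) (m : Fin (numMid g)),
    Fin (numExits (callB g m)) → Fin (numExits g)
  head : Grp k
  value : Fin (numExits head) → V

namespace MockCFLOBDD

variable {k : ℕ} {V : Type*}

attribute [instance] MockCFLOBDD.fintypeGrp

/-- The groupings that can be reached from the head along call edges. -/
inductive Reachable (C : MockCFLOBDD k V) : ∀ {l : ℕ}, C.Grp l → Prop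
  | head : Reachable C C.head
  | callA {l : ℕ} {g : C.Grp (l + 1)} : Reachable C g → Reachable C (C.callA g)
  | callB {l : ℕ} {g : C.Grp (l + 1)} (m : Fin (C.numMid g)) :
      Reachable C g → Reachable C (C.callB g m)

/-- The exit vertex of `g` at which the matched path for the assignment `x` to `2 ^ l` variables
leaves the proto-CFLOBDD headed by `g`. At level `0` the next variable is read. At level `l + 1`
the path goes through the A-callee, which reads the first `2 ^ l` variables, comes back along the
matching A-return edge to a middle vertex `m`, goes through the B-callee of `m`, which reads the
other `2 ^ l` variables, and comes back along the matching B-return edge. -/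
def exitOf (C : MockCFLOBDD k V) :
    ∀ {l : ℕ} (g : C.Grp l), (Fin (2 ^ l) → Bool) → Fin (C.numExits g)
  | 0, g, x => ⟨if C.isFork g && x 0 then 1 else 0, by
      rw [C.numExits_zero g]; cases C.isFork g <;> cases x 0 <;> simp⟩
  | l + 1, g, x =>
      let m := C.retA g (C.exitOf (C.callA g)
        (fun i => x ⟨i, by have := i.isLt; rw [pow_succ]; omega⟩))
      C.retB g m (C.exitOf (C.callB g m)
        (fun i => x ⟨2 ^ l + i, by have := i.isLt; rw [pow_succ]; omega⟩))

/-- The result of interpreting the assignment `x`, where `x i` is the value of the `i`-th variable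
that is read. -/
def eval (C : MockCFLOBDD k V) (x : Fin (2 ^ k) → Bool) : V :=
  C.value (C.exitOf C.head x)

/-- The return tuple of the A-connection of `g`. -/
def tupleA (C : MockCFLOBDD k V) {l : ℕ} (g : C.Grp (l + 1)) : List ℕ :=
  List.ofFn fun e => (C.retA g e : ℕ)

/-- The return tuple of the B-connection of the middle vertex `m` of `g`. -/
def tupleB (C : MockCFLOBDD k V) {l : ℕ} (g : C.Grp (l + 1)) (m : Fin (C.numMid g)) : List ℕ :=
  List.ofFn fun e => (C.retB g m e : ℕ)

/-- Equality (up to isomorphism) of the proto-CFLOBDDs headed by two groupings, defined inductively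
on their hierarchical structure. -/
def SameProto (C : MockCFLOBDD k V) : ∀ {l : ℕ}, C.Grp l → C.Grp l → Prop
  | 0, g, h => C.isFork g = C.isFork h
  | _ + 1, g, h =>
      C.numExits g = C.numExits h ∧
      C.SameProto (C.callA g) (C.callA h) ∧ C.tupleA g = C.tupleA h ∧
      ∃ e : C.numMid g = C.numMid h, ∀ m : Fin (C.numMid g),
        C.SameProto (C.callB g m) (C.callB h (Fin.cast e m)) ∧
        C.tupleB g m = C.tupleB h (Fin.cast e m)

/-- The number of exit vertices of `g` up to and including the rightmost one that is a target of
the B-connections of the middle vertices before `m` (`0` if there is no such target). -/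
def exitsBefore (C : MockCFLOBDD k V) {l : ℕ} (g : C.Grp (l + 1)) (m : Fin (C.numMid g)) : ℕ :=
  (Finset.univ.filter (· < m)).sup fun j => Finset.univ.sup fun e => (C.retB g j e : ℕ) + 1

/-- The structural invariants that make a mock-CFLOBDD a CFLOBDD. -/
structure IsCFLOBDD (C : MockCFLOBDD k V) : Prop where
  /-- The structure consists of the head and the groupings to which it is connected. -/
  reachable : ∀ {l : ℕ} (g : C.Grp l), C.Reachable g
  /-- A-returns map the exits of the callee one-to-one, in order, onto the middle vertices. -/
  retA_onto : ∀ {l : ℕ} (g : C.Grp (l + 1)), C.tupleA g = List.range (C.numMid g)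
  /-- There are no repetitions in a B-return tuple. -/
  retB_injective : ∀ {l : ℕ} (g : C.Grp (l + 1)) (m : Fin (C.numMid g)),
    Function.Injective (C.retB g m)
  /-- Each B-return tuple compactly extends the exits used by the previous ones: its sub-sequence
  of exits beyond those is `n, n + 1, …, n + r - 1`, where `n` is the number of exits before. -/
  retB_compact : ∀ {l : ℕ} (g : C.Grp (l + 1)) (m : Fin (C.numMid g)), ∃ r : ℕ,
    (C.tupleB g m).filter (fun e => C.exitsBefore g m ≤ e) = List.range' (C.exitsBefore g m) r
  /-- Every exit vertex is the target of some B-return edge. -/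
  retB_cover : ∀ {l : ℕ} (g : C.Grp (l + 1)) (e : Fin (C.numExits g)),
    ∃ m : Fin (C.numMid g), e ∈ Set.range (C.retB g m)
  /-- There are no two separate instances of equal proto-CFLOBDDs. -/
  shared : ∀ {l : ℕ} (g h : C.Grp l), C.SameProto g h → g = h
  /-- B-connections of different middle vertices of a grouping that call equal proto-CFLOBDDs have
  different return tuples. -/
  retB_distinct : ∀ {l : ℕ} (g : C.Grp (l + 1)) (m m' : Fin (C.numMid g)), m ≠ m' →
    C.SameProto (C.callB g m) (C.callB g m') → C.tupleB g m ≠ C.tupleB g m'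
  /-- The exits of the head are mapped to distinct terminal values. -/
  value_injective : Function.Injective C.value

/-- `C` represents `f` under the variable ordering `Ord`: the `i`-th variable read is
`Ord i`. -/
def Represents (C : MockCFLOBDD k V) (Ord : Equiv.Perm (Fin (2 ^ k)))
    (f : (Fin (2 ^ k) → Bool) → V) : Prop :=
  ∀ x : Fin (2 ^ k) → Bool, C.eval (fun i => x (Ord i)) = f x

/-- The number of middle vertices of a grouping; there are none at level `0`. -/
def numMiddle (C : MockCFLOBDD k V) : ∀ {l : ℕ}, C.Grp l → ℕ
  | 0, _ => 0
  | _ + 1, g => C.numMid g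

/-- The number of vertices of `C`: each grouping has one entry vertex, its middle vertices and
its exit vertices. -/
def numVertices (C : MockCFLOBDD k V) : ℕ :=
  ∑ l ∈ Finset.range (k + 1), ∑ g : C.Grp l, (1 + C.numMiddle g + C.numExits g)

end MockCFLOBDD

/-!
Call the function that remains of `f` after its first variables have been read a cofactor of `f`.
The exits of a grouping partition the assignments it reads, and this partition determines the
grouping: the A-callee and the B-callees are determined inductively by the partitions they induce,
and the exits are numbered in the order of their first use. Hence a grouping of `C` at level `l` is
determined by any cofactor `R` of `f` that it classifies, i.e. whose cofactors after `2 ^ l` further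
variables correspond to its exits. Nodes of `B` determine cofactors of `f`, so a grouping is
determined by its level and by a node `u` of `B`, and its exits correspond to different nodes
`2 ^ l` plies below `u`. The pair of `u` and such a node determines both the grouping and the exit,
as the level can be read off from the difference of the depths. So `C` has at most `|B| ^ 2` exit
vertices. The middle vertices are the exits of the A-callees, which start at the same node `u`.
-/

section Streams

variable {α : Type*} {β : Type*}

theorem get_take_append_of_lt (s t : Stream' α) {m i : ℕ} (h : i < m) :
    (s.take m ++ₛ t).get i = s.get i := by
  rw [Stream'.get_append_left _ _ _ (by rwa [Stream'.length_take]), Stream'.take_get]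

theorem drop_take_append (s t : Stream' α) (m : ℕ) : (s.take m ++ₛ t).drop m = t := by
  simpa only [Stream'.length_take] using Stream'.drop_append_stream (s.take m) t

theorem take_add_take_append (s t : Stream' α) (m n : ℕ) :
    (s.take m ++ₛ t).take (m + n) = s.take m ++ t.take n := by
  simpa only [Stream'.length_take] using (Stream'.append_take n (s.take m) t).symm

/-- The cofactor of a function of infinitely many variables with respect to the values `w` of the
first variables: the function of the other variables that is left when those are fixed. -/
def cofactor (R : Stream' α → β) (w : List α) : Stream' α → β := fun s => R (w ++ₛ s)

theorem cofactor_append (R : Stream' α → β) (v w : List α) :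
    cofactor R (v ++ w) = cofactor (cofactor R v) w :=
  funext fun s => congrArg R (Stream'.append_append_stream v w s)

theorem eq_of_cofactor_take_eq {P Q : Stream' α → β} (m : ℕ)
    (h : ∀ s : Stream' α, cofactor P (s.take m) = cofactor Q (s.take m)) : P = Q := by
  funext s
  simpa only [cofactor, Stream'.append_take_drop] using congrFun (h s) (s.drop m)

end Streams

section RestrictedGrowth

variable {ι κ α : Type*}

/-- A sequence has restricted growth if every value below one of its terms occurs at an earlier
position. Terms are indexed by `ι` and ordered by their positions in `κ`; several indices may have
the same position. -/
def IsRestrictedGrowth [LT κ] [LT α] (position : ι → κ) (a : ι → α) : Prop :=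
  ∀ i, ∀ v < a i, ∃ j, position j < position i ∧ a j = v

theorem IsRestrictedGrowth.eq_of_ker_eq [Preorder κ] [WellFoundedLT κ] [LinearOrder α]
    {position : ι → κ} {a b : ι → α} (ha : IsRestrictedGrowth position a)
    (hb : IsRestrictedGrowth position b) (hker : Setoid.ker a = Setoid.ker b) : a = b := by
  have ker_iff (i j : ι) : a i = a j ↔ b i = b j := by
    rw [← Setoid.ker_def, hker, Setoid.ker_def]
  funext i
  induction i using (InvImage.wf position wellFounded_lt).induction with
  | _ i ih =>
    rcases lt_trichotomy (a i) (b i) with hlt | heq | hlt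
    · obtain ⟨j, hji, hj⟩ := hb i _ hlt
      rw [← hj, (ker_iff i j).1 (((ih j hji).trans hj).symm)]
    · exact heq
    · obtain ⟨j, hji, hj⟩ := ha i _ hlt
      rw [← hj, (ker_iff i j).2 (((ih j hji).symm.trans hj).symm)]

end RestrictedGrowth

/-- The pair of `top g` and the image of `e` determines `l` (by the difference of the depths), then
`g`, then `e`. -/
theorem sum_sum_le_card_sq {α : Type*} [Fintype α] (depth : α → ℕ) {p : ℕ → ℕ}
    (hp : Function.Injective p) {G : ℕ → Type*} [∀ l, Fintype (G l)] (N : ∀ l, G l → ℕ)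
    {top : ∀ l, G l → α} (htop : ∀ l, Function.Injective (top l))
    (hbot : ∀ l (g : G l), ∃ bot : Fin (N l g) → α,
      Function.Injective bot ∧ ∀ e, depth (bot e) = depth (top l g) + p l) (k : ℕ) :
    ∑ l ∈ Finset.range k, ∑ g : G l, N l g ≤ Fintype.card α ^ 2 := by
  choose bot bot_injective depth_bot using hbot
  let φ : (Σ l : Fin k, Σ g : G l, Fin (N l g)) → α × α :=
    fun x => (top x.1 x.2.1, bot x.1 x.2.1 x.2.2)
  have hφ : Function.Injective φ := by
    rintro ⟨l, g, e⟩ ⟨l', g', e'⟩ h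
    obtain ⟨htop_eq, hbot_eq⟩ := Prod.mk.inj h
    have hdepth := depth_bot l g e
    rw [hbot_eq, depth_bot, htop_eq] at hdepth
    obtain rfl : l' = l := Fin.ext (hp (Nat.add_left_cancel hdepth))
    obtain rfl := htop _ htop_eq
    obtain rfl := bot_injective _ _ hbot_eq
    rfl
  have hcard := Fintype.card_le_of_injective φ hφ
  simp only [Fintype.card_sigma, Fintype.card_fin, Fintype.card_prod] at hcard
  rwa [Fin.sum_univ_eq_sum_range fun l => ∑ g : G l, N l g, ← sq] at hcard

namespace MockCFLOBDD

variable {k : ℕ} {V : Type*} {C : MockCFLOBDD k V} {l : ℕ}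

/-- The exit vertex of `g` reached by the first `2 ^ l` bits of a stream. Reading from streams
avoids casts between the sizes of assignments at different levels. -/
def exit (C : MockCFLOBDD k V) (g : C.Grp l) (s : Stream' Bool) : Fin (C.numExits g) :=
  C.exitOf g fun i => s.get i

/-- The middle vertex of `g` to which the A-callee returns on a stream. -/
def mid (C : MockCFLOBDD k V) (g : C.Grp (l + 1)) (s : Stream' Bool) : Fin (C.numMid g) :=
  C.retA g (C.exit (C.callA g) s)

/-- The exit vertex of `g` to which the B-callee of the middle vertex `m` returns on a stream. -/
def out (C : MockCFLOBDD k V) (g : C.Grp (l + 1)) (m : Fin (C.numMid g)) (s : Stream' Bool) :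
    Fin (C.numExits g) :=
  C.retB g m (C.exit (C.callB g m) s)

theorem exit_congr (g : C.Grp l) {s t : Stream' Bool} (h : ∀ i < 2 ^ l, s.get i = t.get i) :
    C.exit g s = C.exit g t :=
  congrArg (C.exitOf g) (funext fun i => h i i.isLt)

theorem exit_take_append (g : C.Grp l) (s t : Stream' Bool) :
    C.exit g (s.take (2 ^ l) ++ₛ t) = C.exit g s :=
  exit_congr g fun _ hi => get_take_append_of_lt s t hi

theorem exit_zero_val (g : C.Grp 0) (s : Stream' Bool) :
    (C.exit g s : ℕ) = if C.isFork g && s.get 0 then 1 else 0 := rfl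

theorem exit_succ (g : C.Grp (l + 1)) (s : Stream' Bool) :
    C.exit g s = C.out g (C.mid g s) (s.drop (2 ^ l)) := by
  have hdrop : s.drop (2 ^ l) = fun i => s.get (2 ^ l + i) :=
    funext fun i => congrArg s.get (Nat.add_comm i _)
  rw [hdrop]
  rfl

theorem exit_succ_take_append (g : C.Grp (l + 1)) (s t : Stream' Bool) :
    C.exit g (s.take (2 ^ l) ++ₛ t) = C.out g (C.mid g s) t := by
  rw [exit_succ, drop_take_append, mid, exit_take_append, mid]

theorem sameProto_refl (C : MockCFLOBDD k V) : ∀ {l : ℕ} (g : C.Grp l), C.SameProto g g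
  | 0, _ => by rw [SameProto]
  | _ + 1, g => by
    rw [SameProto]
    exact ⟨rfl, sameProto_refl C _, rfl, rfl, fun m => ⟨sameProto_refl C _, rfl⟩⟩

/-- The grouping `g` classifies the function `R` if its exits correspond to the cofactors of `R`
with respect to the first `2 ^ l` variables. -/
def Classifies (C : MockCFLOBDD k V) {α : Type*} (g : C.Grp l) (R : Stream' Bool → α) : Prop :=
  ∀ s t : Stream' Bool, C.exit g s = C.exit g t ↔
    cofactor R (s.take (2 ^ l)) = cofactor R (t.take (2 ^ l))

theorem classifies_comp_exit {α : Type*} (g : C.Grp l) {φ : Fin (C.numExits g) → α}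
    (hφ : Function.Injective φ) : C.Classifies g (φ ∘ C.exit g) := fun s t => by
  have hconst (s : Stream' Bool) :
      cofactor (φ ∘ C.exit g) (s.take (2 ^ l)) = Function.const _ (φ (C.exit g s)) :=
    funext fun u => congrArg φ (exit_take_append g s u)
  rw [hconst, hconst, Function.const_inj, hφ.eq_iff]

theorem classifies_exit (g : C.Grp l) : C.Classifies g (C.exit g) :=
  classifies_comp_exit g Function.injective_id

theorem Classifies.ker_eq {α : Type*} {g h : C.Grp l} {R : Stream' Bool → α}
    (hg : C.Classifies g R) (hh : C.Classifies h R) :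
    Setoid.ker (C.exit g) = Setoid.ker (C.exit h) :=
  Setoid.ext fun s t => (hg s t).trans (hh s t).symm

theorem Classifies.of_ker_eq {α : Type*} {g h : C.Grp l} {R : Stream' Bool → α}
    (hg : C.Classifies g R) (hgh : Setoid.ker (C.exit g) = Setoid.ker (C.exit h)) :
    C.Classifies h R := fun s t =>
  (Setoid.ext_iff.1 hgh s t).symm.trans (hg s t)

/-- The B-return edge used by the matched path for a stream: the number of its middle vertex and the
number of the exit of the B-callee. -/
def returnEdge (C : MockCFLOBDD k V) (g : C.Grp (l + 1)) (s : Stream' Bool) : ℕ ×ₗ ℕ :=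
  toLex (C.mid g s, C.exit (C.callB g (C.mid g s)) (s.drop (2 ^ l)))

namespace IsCFLOBDD

section Invariants

variable (hC : C.IsCFLOBDD)
include hC

theorem numExits_callA (g : C.Grp (l + 1)) : C.numExits (C.callA g) = C.numMid g := by
  simpa only [tupleA, List.length_ofFn, List.length_range] using
    congrArg List.length (hC.retA_onto g)

theorem retA_val (g : C.Grp (l + 1)) (e : Fin (C.numExits (C.callA g))) :
    (C.retA g e : ℕ) = e := by
  have h := congrArg (fun L => L[(e : ℕ)]?) (hC.retA_onto g)
  simpa [tupleA, ← hC.numExits_callA g] using h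

theorem mid_val (g : C.Grp (l + 1)) (s : Stream' Bool) :
    (C.mid g s : ℕ) = C.exit (C.callA g) s :=
  hC.retA_val g _

theorem mid_eq_mid_iff (g : C.Grp (l + 1)) (s t : Stream' Bool) :
    C.mid g s = C.mid g t ↔ C.exit (C.callA g) s = C.exit (C.callA g) t := by
  rw [Fin.ext_iff, Fin.ext_iff, hC.mid_val, hC.mid_val]

theorem out_eq_out_iff (g : C.Grp (l + 1)) (m : Fin (C.numMid g)) (s t : Stream' Bool) :
    C.out g m s = C.out g m t ↔ C.exit (C.callB g m) s = C.exit (C.callB g m) t :=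
  (hC.retB_injective g m).eq_iff

theorem mid_surjective_of_exit_callA_surjective {g : C.Grp (l + 1)}
    (h : Function.Surjective (C.exit (C.callA g))) : Function.Surjective (C.mid g) := fun m => by
  obtain ⟨s, hs⟩ := h (Fin.cast (hC.numExits_callA g).symm m)
  exact ⟨s, Fin.ext (by rw [hC.mid_val, hs, Fin.val_cast])⟩

theorem exit_surjective : ∀ {l : ℕ} (g : C.Grp l), Function.Surjective (C.exit g)
  | 0, g, e => by
    refine ⟨Stream'.const (decide ((e : ℕ) = 1)), Fin.ext ?_⟩
    have he := e.isLt.trans_eq (C.numExits_zero g)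
    rw [exit_zero_val, Stream'.get_const]
    cases hg : C.isFork g <;> simp only [hg] at he ⊢ <;> grind
  | l + 1, g, e => by
    obtain ⟨m, b, rfl⟩ := hC.retB_cover g e
    obtain ⟨s, rfl⟩ := hC.mid_surjective_of_exit_callA_surjective (exit_surjective (C.callA g)) m
    obtain ⟨t, rfl⟩ := exit_surjective (C.callB g (C.mid g s)) b
    exact ⟨s.take (2 ^ l) ++ₛ t, exit_succ_take_append g s t⟩

theorem mid_surjective (g : C.Grp (l + 1)) : Function.Surjective (C.mid g) :=
  hC.mid_surjective_of_exit_callA_surjective (hC.exit_surjective _)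

theorem range_exit_val (g : C.Grp l) :
    Set.range (fun s => (C.exit g s : ℕ)) = Set.Iio (C.numExits g) := by
  rw [← Fin.range_val]
  exact (hC.exit_surjective g).range_comp Fin.val

theorem ofFn_eq_ofFn_of_exit {g h : C.Grp l} (hgh : g = h) {β : Type*}
    {a : Fin (C.numExits g) → β} {b : Fin (C.numExits h) → β}
    (hab : ∀ s, a (C.exit g s) = b (C.exit h s)) : List.ofFn a = List.ofFn b := by
  subst hgh
  exact congrArg List.ofFn (funext ((hC.exit_surjective g).forall.2 hab))

theorem retB_lt_retB_of_exitsBefore_le {g : C.Grp (l + 1)} {m : Fin (C.numMid g)}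
    {e e' : Fin (C.numExits (C.callB g m))} (hlt : e < e')
    (he : C.exitsBefore g m ≤ C.retB g m e) (he' : C.exitsBefore g m ≤ C.retB g m e') :
    C.retB g m e < C.retB g m e' := by
  obtain ⟨r, hr⟩ := hC.retB_compact g m
  have hsorted := List.pairwise_lt_range' (s := C.exitsBefore g m) (n := r)
  rw [← hr, List.pairwise_filter, tupleB, List.pairwise_ofFn] at hsorted
  exact hsorted hlt (decide_eq_true he) (decide_eq_true he')

theorem exists_retB_eq_of_exitsBefore_le {g : C.Grp (l + 1)} {m : Fin (C.numMid g)}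
    {e : Fin (C.numExits (C.callB g m))} {v : ℕ} (hv : C.exitsBefore g m ≤ v)
    (hve : v < C.retB g m e) : ∃ e' < e, (C.retB g m e' : ℕ) = v := by
  obtain ⟨r, hr⟩ := hC.retB_compact g m
  have mem_range'_iff (u : ℕ) : u ∈ List.range' (C.exitsBefore g m) r ↔
      (∃ e', (C.retB g m e' : ℕ) = u) ∧ C.exitsBefore g m ≤ u := by
    rw [← hr, List.mem_filter, tupleB, List.mem_ofFn, decide_eq_true_iff]
  have he_mem := (mem_range'_iff _).2 ⟨⟨e, rfl⟩, hv.trans hve.le⟩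
  have hv_mem : v ∈ List.range' (C.exitsBefore g m) r := by
    rw [List.mem_range'_1] at he_mem ⊢
    omega
  obtain ⟨⟨e', rfl⟩, -⟩ := (mem_range'_iff v).1 hv_mem
  refine ⟨e', ?_, rfl⟩
  by_contra! hle
  rcases hle.eq_or_lt with rfl | hlt
  · exact lt_irrefl _ hve
  · exact lt_asymm hve (hC.retB_lt_retB_of_exitsBefore_le hlt (hv.trans hve.le) hv)

theorem exists_earlier_retB_eq {g : C.Grp (l + 1)} (m : Fin (C.numMid g))
    (e : Fin (C.numExits (C.callB g m))) {v : ℕ} (hv : v < C.retB g m e) :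
    ∃ (m' : Fin (C.numMid g)) (e' : Fin (C.numExits (C.callB g m'))),
      toLex ((m' : ℕ), (e' : ℕ)) < toLex ((m : ℕ), (e : ℕ)) ∧ (C.retB g m' e' : ℕ) = v := by
  induction m using WellFoundedLT.induction with
  | ind m ih =>
    rcases lt_or_ge v (C.exitsBefore g m) with hlt | hge
    · simp only [exitsBefore, Finset.lt_sup_iff, Finset.mem_filter, Finset.mem_univ, true_and,
        Nat.lt_succ_iff] at hlt
      obtain ⟨j, hjm, i, hi⟩ := hlt
      have hlex : toLex ((j : ℕ), (i : ℕ)) < toLex ((m : ℕ), (e : ℕ)) :=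
        Prod.Lex.toLex_lt_toLex.2 (Or.inl hjm)
      rcases hi.eq_or_lt with rfl | hi
      · exact ⟨j, i, hlex, rfl⟩
      · obtain ⟨m', e', hlex', he'⟩ := ih j hjm i hi
        exact ⟨m', e', hlex'.trans hlex, he'⟩
    · obtain ⟨e', hlt, he'⟩ := hC.exists_retB_eq_of_exitsBefore_le hge hv
      exact ⟨m, e', Prod.Lex.toLex_lt_toLex.2 (Or.inr ⟨rfl, hlt⟩), he'⟩

theorem isRestrictedGrowth_exit (g : C.Grp (l + 1)) :
    IsRestrictedGrowth (C.returnEdge g) fun s => (C.exit g s : ℕ) := by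
  intro s v hv
  beta_reduce at hv
  rw [exit_succ] at hv
  obtain ⟨m', e', hlex, rfl⟩ := hC.exists_earlier_retB_eq _ _ hv
  obtain ⟨x, rfl⟩ := hC.mid_surjective g m'
  obtain ⟨t, rfl⟩ := hC.exit_surjective _ e'
  refine ⟨x.take (2 ^ l) ++ₛ t, ?_, congrArg Fin.val (exit_succ_take_append g x t)⟩
  have hmid : C.mid g (x.take (2 ^ l) ++ₛ t) = C.mid g x :=
    congrArg (C.retA g) (exit_take_append _ x t)
  rwa [returnEdge, drop_take_append, hmid]

theorem sameProto_of_exit_val_eq {g h : C.Grp (l + 1)} (hA : C.callA g = C.callA h)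
    (hB : ∀ s, C.callB g (C.mid g s) = C.callB h (C.mid h s))
    (hexit : ∀ s, (C.exit g s : ℕ) = C.exit h s) : C.SameProto g h := by
  have hnumExits : C.numExits g = C.numExits h := Set.Iio_injective <| by
    rw [← hC.range_exit_val, ← hC.range_exit_val, funext hexit]
  have hnumMid : C.numMid g = C.numMid h := by
    rw [← hC.numExits_callA, hA, hC.numExits_callA]
  rw [SameProto]
  refine ⟨hnumExits, hA ▸ C.sameProto_refl _, by rw [hC.retA_onto, hC.retA_onto, hnumMid],
    hnumMid, (hC.mid_surjective g).forall.2 fun x => ?_⟩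
  have hmid : Fin.cast hnumMid (C.mid g x) = C.mid h x :=
    Fin.ext (by rw [Fin.val_cast, hC.mid_val, hC.mid_val, hA])
  rw [hmid]
  refine ⟨hB x ▸ C.sameProto_refl _, hC.ofFn_eq_ofFn_of_exit (hB x) fun s => ?_⟩
  have hs := hexit (x.take (2 ^ l) ++ₛ s)
  rwa [exit_succ_take_append, exit_succ_take_append] at hs

end Invariants

end IsCFLOBDD

theorem Classifies.out_eq_out_iff {α : Type*} {g : C.Grp (l + 1)} {R : Stream' Bool → α}
    (hg : C.Classifies g R) (x y s t : Stream' Bool) :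
    C.out g (C.mid g x) s = C.out g (C.mid g y) t ↔
      cofactor (cofactor R (x.take (2 ^ l))) (s.take (2 ^ l)) =
        cofactor (cofactor R (y.take (2 ^ l))) (t.take (2 ^ l)) := by
  rw [← exit_succ_take_append, ← exit_succ_take_append, hg, pow_succ, mul_two,
    take_add_take_append, take_add_take_append, cofactor_append, cofactor_append]

theorem Classifies.callB {α : Type*} {g : C.Grp (l + 1)} {R : Stream' Bool → α}
    (hg : C.Classifies g R) (hC : C.IsCFLOBDD) (x : Stream' Bool) :
    C.Classifies (C.callB g (C.mid g x)) (cofactor R (x.take (2 ^ l))) := fun s t => by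
  rw [← hC.out_eq_out_iff, hg.out_eq_out_iff]

theorem IsCFLOBDD.eq_of_out_eq (hC : C.IsCFLOBDD)
    (hinj : Function.Injective fun g : C.Grp l => Setoid.ker (C.exit g))
    {g : C.Grp (l + 1)} {m m' : Fin (C.numMid g)} (h : C.out g m = C.out g m') : m = m' := by
  have hcallB : C.callB g m = C.callB g m' := hinj <| Setoid.ext fun s t => by
    simp only [Setoid.ker_def]
    rw [← hC.out_eq_out_iff, ← hC.out_eq_out_iff, h]
  by_contra hne
  exact hC.retB_distinct g m m' hne (hcallB ▸ C.sameProto_refl _)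
    (hC.ofFn_eq_ofFn_of_exit hcallB fun s => congrArg Fin.val (congrFun h s))

theorem Classifies.callA_of_injective {α : Type*} {g : C.Grp (l + 1)} {R : Stream' Bool → α}
    (hg : C.Classifies g R) (hC : C.IsCFLOBDD)
    (hinj : Function.Injective fun g : C.Grp l => Setoid.ker (C.exit g)) :
    C.Classifies (C.callA g) R := fun s t => by
  rw [← hC.mid_eq_mid_iff]
  constructor <;> intro h
  · exact eq_of_cofactor_take_eq _ fun u => (hg.out_eq_out_iff s t u u).1 (by rw [h])
  · exact hC.eq_of_out_eq hinj (funext fun u => (hg.out_eq_out_iff s t u u).2 (by rw [h]))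

theorem IsCFLOBDD.ker_exit_injective (hC : C.IsCFLOBDD) :
    ∀ l : ℕ, Function.Injective fun g : C.Grp l => Setoid.ker (C.exit g)
  | 0, g, h, hgh => by
    have hfork := Setoid.ext_iff.1 hgh (Stream'.const true) (Stream'.const false)
    simp only [Setoid.ker_def, Fin.ext_iff, exit_zero_val, Stream'.get_const] at hfork
    refine hC.shared g h ?_
    rw [SameProto]
    cases hg : C.isFork g <;> cases hh : C.isFork h <;> simp_all
  | l + 1, g, h, hgh => by
    have ih := hC.ker_exit_injective l
    have hg := C.classifies_exit g
    have hh : C.Classifies h (C.exit g) := hg.of_ker_eq hgh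
    have hA : C.callA g = C.callA h :=
      ih ((hg.callA_of_injective hC ih).ker_eq (hh.callA_of_injective hC ih))
    have hB (s : Stream' Bool) : C.callB g (C.mid g s) = C.callB h (C.mid h s) :=
      ih ((hg.callB hC s).ker_eq (hh.callB hC s))
    have hreturnEdge : C.returnEdge g = C.returnEdge h := funext fun s => by
      rw [returnEdge, returnEdge, hB, hC.mid_val, hC.mid_val, hA]
    have hexit := (hreturnEdge ▸ hC.isRestrictedGrowth_exit g).eq_of_ker_eq
      (hC.isRestrictedGrowth_exit h) <| by
        ext s t
        simpa only [Setoid.ker_def, Fin.val_inj] using Setoid.ext_iff.1 hgh s t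
    exact hC.shared g h (hC.sameProto_of_exit_val_eq hA hB (congrFun hexit))

theorem Classifies.callA {α : Type*} {g : C.Grp (l + 1)} {R : Stream' Bool → α}
    (hg : C.Classifies g R) (hC : C.IsCFLOBDD) : C.Classifies (C.callA g) R :=
  hg.callA_of_injective hC (hC.ker_exit_injective l)

theorem Classifies.eq {α : Type*} {g h : C.Grp l} {R : Stream' Bool → α}
    (hg : C.Classifies g R) (hh : C.Classifies h R) (hC : C.IsCFLOBDD) : g = h :=
  hC.ker_exit_injective l (hg.ker_eq hh)

end MockCFLOBDD

namespace DecisionDiagram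

variable {n : ℕ} {V : Type*} {B : DecisionDiagram n V}

/-- The nodes of `B`, tagged with their depths. -/
abbrev Vertex (B : DecisionDiagram n V) : Type := Σ d : Fin (n + 1), B.Node d

theorem card_vertex (B : DecisionDiagram n V) : Fintype.card B.Vertex = B.size := by
  rw [Fintype.card_sigma, Fin.sum_univ_eq_sum_range fun d => Fintype.card (B.Node d), size]

/-- The result of interpreting the first `n` bits of a stream. -/
def evalStream (B : DecisionDiagram n V) (s : Stream' Bool) : V :=
  B.eval fun i => s.get i

/-- The node at depth `d` reached by the first `d` bits of a stream. -/
def path (B : DecisionDiagram n V) (s : Stream' Bool) (d : ℕ) (h : d ≤ n) : B.Node d :=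
  B.walk (fun i => s.get i) d h

theorem path_succ (s : Stream' Bool) {d : ℕ} (h : d + 1 ≤ n) :
    B.path s (d + 1) h = B.child h (B.path s d (Nat.le_of_succ_le h)) (s.get d) := rfl

theorem path_congr {s t : Stream' Bool} :
    ∀ {d : ℕ} (h : d ≤ n), (∀ i < d, s.get i = t.get i) → B.path s d h = B.path t d h
  | 0, _, _ => rfl
  | d + 1, h, hst => by
    rw [path_succ, path_succ, hst d d.lt_succ_self,
      path_congr (Nat.le_of_succ_le h) fun i hi => hst i (hi.trans d.lt_succ_self)]

theorem path_take_append {d : ℕ} (h : d ≤ n) (s u : Stream' Bool) :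
    B.path (s.take d ++ₛ u) d h = B.path s d h :=
  path_congr h fun _ hi => get_take_append_of_lt s u hi

theorem path_take_append_eq {d e : ℕ} (hde : d ≤ e) (he : e ≤ n) {s t : Stream' Bool}
    (hst : B.path s d (hde.trans he) = B.path t d (hde.trans he)) (u : Stream' Bool) :
    B.path (s.take d ++ₛ u) e he = B.path (t.take d ++ₛ u) e he := by
  induction e, hde using Nat.le_induction with
  | base => rwa [path_take_append, path_take_append]
  | succ e hde ih =>
    have hget (s : Stream' Bool) : (s.take d ++ₛ u).get e = u.get (e - d) := by
      obtain ⟨m, rfl⟩ := Nat.exists_eq_add_of_le hde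
      simpa only [Stream'.length_take, Nat.add_sub_cancel_left] using
        Stream'.get_append_right m (s.take d) u
    rw [path_succ, path_succ, ih _ hst, hget, hget]

theorem cofactor_evalStream_eq {d : ℕ} (hd : d ≤ n) {s t : Stream' Bool}
    (hst : B.path s d hd = B.path t d hd) :
    cofactor B.evalStream (s.take d) = cofactor B.evalStream (t.take d) :=
  funext fun u => congrArg B.value (path_take_append_eq hd le_rfl hst u)

end DecisionDiagram

namespace MockCFLOBDD

variable {n k : ℕ} {V : Type*} {C : MockCFLOBDD k V} {B : DecisionDiagram n V} {l : ℕ}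

/-- The grouping `g` does the work of the `2 ^ l` plies of `B` below the node `u`: it classifies the
cofactor of the function of `B` with respect to some path that leads to `u`. -/
def RootedAt (C : MockCFLOBDD k V) (g : C.Grp l) (u : B.Vertex) : Prop :=
  (u.1 : ℕ) + 2 ^ l ≤ n ∧ ∃ X : Stream' Bool, B.path X u.1 u.1.is_le = u.2 ∧
    C.Classifies g (cofactor B.evalStream (X.take u.1))

namespace RootedAt

theorem eq {g h : C.Grp l} {u : B.Vertex} (hg : C.RootedAt g u) (hh : C.RootedAt h u)
    (hC : C.IsCFLOBDD) : g = h := by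
  obtain ⟨-, X, hX, hgX⟩ := hg
  obtain ⟨-, Y, hY, hhY⟩ := hh
  rw [DecisionDiagram.cofactor_evalStream_eq _ (hX.trans hY.symm)] at hgX
  exact hgX.eq hhY hC

theorem callA {g : C.Grp (l + 1)} {u : B.Vertex} (hg : C.RootedAt g u) (hC : C.IsCFLOBDD) :
    C.RootedAt (C.callA g) u := by
  obtain ⟨hle, X, hX, hgX⟩ := hg
  rw [pow_succ] at hle
  exact ⟨by omega, X, hX, hgX.callA hC⟩

theorem exists_callB {g : C.Grp (l + 1)} {u : B.Vertex} (hg : C.RootedAt g u) (hC : C.IsCFLOBDD)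
    (m : Fin (C.numMid g)) : ∃ v : B.Vertex, C.RootedAt (C.callB g m) v := by
  obtain ⟨hle, X, -, hgX⟩ := hg
  obtain ⟨x, rfl⟩ := hC.mid_surjective g m
  rw [pow_succ, mul_two, ← add_assoc] at hle
  have hgXx := hgX.callB hC x
  rw [← cofactor_append, ← take_add_take_append] at hgXx
  exact ⟨⟨⟨u.1 + 2 ^ l, by omega⟩, B.path (X.take u.1 ++ₛ x) _ (by omega)⟩, hle, _, rfl, hgXx⟩

theorem exists_injective_vertex {g : C.Grp l} {u : B.Vertex} (hg : C.RootedAt g u)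
    (hC : C.IsCFLOBDD) : ∃ v : Fin (C.numExits g) → B.Vertex,
      Function.Injective v ∧ ∀ e, ((v e).1 : ℕ) = u.1 + 2 ^ l := by
  obtain ⟨hle, X, -, hgX⟩ := hg
  choose s hs using hC.exit_surjective g
  refine ⟨fun e => ⟨⟨u.1 + 2 ^ l, by omega⟩, B.path (X.take u.1 ++ₛ s e) _ hle⟩,
    fun e e' hee => ?_, fun _ => rfl⟩
  have hcofactor := DecisionDiagram.cofactor_evalStream_eq hle (eq_of_heq (Sigma.mk.inj hee).2)
  rw [take_add_take_append, take_add_take_append, cofactor_append, cofactor_append, ← hgX, hs,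
    hs] at hcofactor
  exact hcofactor

end RootedAt

theorem Represents.eval_eq {f : (Fin (2 ^ k) → Bool) → V} {Ord : Equiv.Perm (Fin (2 ^ k))}
    {B : DecisionDiagram (2 ^ k) V} (hCf : C.Represents Ord f) (hBf : B.Represents Ord f) :
    C.eval = B.eval := funext fun x => by
  simpa only [Equiv.symm_apply_apply] using
    (hCf fun j => x (Ord.symm j)).trans (hBf fun j => x (Ord.symm j)).symm

theorem IsCFLOBDD.rootedAt_head (hC : C.IsCFLOBDD) {B : DecisionDiagram (2 ^ k) V}
    (heval : C.eval = B.eval) : C.RootedAt C.head (⟨0, B.root⟩ : B.Vertex) := by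
  refine ⟨(Nat.zero_add _).le, Stream'.const false, rfl, ?_⟩
  have hfun : cofactor B.evalStream ((Stream'.const false).take 0) = C.value ∘ C.exit C.head :=
    funext fun s => (congrFun heval fun i => s.get i).symm
  exact hfun ▸ classifies_comp_exit C.head hC.value_injective

theorem IsCFLOBDD.exists_rootedAt (hC : C.IsCFLOBDD) {B : DecisionDiagram (2 ^ k) V}
    (heval : C.eval = B.eval) (g : C.Grp l) : ∃ u : B.Vertex, C.RootedAt g u := by
  induction hC.reachable g with
  | head => exact ⟨_, hC.rootedAt_head heval⟩
  | callA _ ih => exact ih.imp fun _ hu => hu.callA hC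
  | callB m _ ih => exact ih.elim fun _ hu => hu.exists_callB hC m

theorem numVertices_le (C : MockCFLOBDD k V) : C.numVertices ≤
    ∑ l ∈ Finset.range k, ∑ g : C.Grp (l + 1), C.numMid g +
      2 * ∑ l ∈ Finset.range (k + 1), ∑ g : C.Grp l, C.numExits g := by
  have hmiddle : ∑ l ∈ Finset.range (k + 1), ∑ g : C.Grp l, C.numMiddle g =
      ∑ l ∈ Finset.range k, ∑ g : C.Grp (l + 1), C.numMid g := by
    rw [Finset.sum_range_succ']
    simp only [numMiddle, Finset.sum_const_zero, add_zero]
  rw [← hmiddle, numVertices]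
  simp only [Finset.mul_sum, ← Finset.sum_add_distrib]
  refine Finset.sum_le_sum fun l _ => Finset.sum_le_sum fun g _ => ?_
  have hpos : 0 < C.numExits g := (C.exit g (Stream'.const false)).pos
  omega

end MockCFLOBDD

theorem mainTheorem3_general {V : Type*} {k : ℕ} {f : (Fin (2 ^ k) → Bool) → V}
    {Ord : Equiv.Perm (Fin (2 ^ k))} {B : DecisionDiagram (2 ^ k) V} {C : MockCFLOBDD k V}
    (hBf : B.Represents Ord f) (hC : C.IsCFLOBDD) (hCf : C.Represents Ord f) :
    C.numVertices ≤ 3 * B.size ^ 2 := by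
  choose top htop using fun l (g : C.Grp l) => hC.exists_rootedAt (hCf.eval_eq hBf) g
  have htop_injective (l : ℕ) : Function.Injective (top l) := fun g g' h =>
    (htop l g).eq (h ▸ htop l g') hC
  let depth (u : B.Vertex) : ℕ := u.1
  have hpow : Function.Injective fun l : ℕ => 2 ^ l := Nat.pow_right_injective le_rfl
  have hexits := sum_sum_le_card_sq depth hpow (fun l (g : C.Grp l) => C.numExits g)
    htop_injective (fun l g => (htop l g).exists_injective_vertex hC) (k + 1)
  have hmiddles := sum_sum_le_card_sq depth hpow (fun l (g : C.Grp (l + 1)) => C.numMid g)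
    (fun l => htop_injective (l + 1))
    (fun l g => hC.numExits_callA g ▸ ((htop _ g).callA hC).exists_injective_vertex hC) k
  have hvertices := C.numVertices_le
  rw [B.card_vertex] at hexits hmiddles
  omega

theorem mainTheorem3 :
    ∃ c : ℕ, ∀ (V : Type*) (k : ℕ) (f : (Fin (2 ^ k) → Bool) → V)
      (Ord : Equiv.Perm (Fin (2 ^ k))) (B : DecisionDiagram (2 ^ k) V) (C : MockCFLOBDD k V),
      B.IsBDD → B.Represents Ord f → C.IsCFLOBDD → C.Represents Ord f →
        C.numVertices ≤ c * B.size ^ 2 :=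
  ⟨3, fun _ _ _ _ _ _ _ hBf hC hCf => mainTheorem3_general hBf hC hCf⟩
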